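/- For every $C>0$ there are constants $\varepsilon_0\in(0,1)$, $b\in\mathbb{N}$ with $b\ge 1$, and $K,c,c'>0$, depending only on $C$, such that the following holds. Let $k,d,n,m,M$ be natural numbers with $n\ge 2$, let $m\ge K\,k\,d\log n$ be the number of samples, and let $B_1,\dots,B_M$ be a partition of $\{1,\dots,m\}$ into batches of size $b$ (so $m=bM$). Let $G:\mathbb{R}^k\to\mathbb{R}^n$ be a $d$-layer feedforward network ($d\ge1$) with ReLU activations whose hidden layers have width at most $n$; that is, each hidden layer is an affine map followed by the coordinatewise ReLU, and the output layer is an affine map with or without ReLU. Let $z^*\in\mathbb{R}^k$ and $\sigma\in\mathbb{R}$. Let $P$ be the law of a pair $(a,y)$ with $y=\langle a,G(z^*)\rangle+\eta$, where * $a$ is a random vector in $\mathbb{R}^n$ that is isotropic, $\mathbb{E}\langle a,u\rangle^2=\|u\|^2$ for all $u$, and has bounded fourth moment with constant $C$, $(\mathbb{E}\langle a,u\rangle^4)^{1/4}\le C(\mathbb{E}\langle a,u\rangle^2)^{1/2}$ for all $u\in\mathbb{R}^n$; * $\eta$ is a real random variable, independent of $a$, with mean $0$ and variance $\sigma^2<\infty$.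 Let $0\le\varepsilon\le\varepsilon_0$, let $Q$ be an arbitrary probability distribution on $\mathbb{R}^n\times\mathbb{R}$, and let $(a_1,y_1),\dots,(a_m,y_m)$ be i.i.d. samples from the mixture $(1-\varepsilon)P+\varepsilon Q$. Put $$\ell_j(z)=\frac1b\sum_{i\in B_j}\bigl(\langle a_i,G(z)\rangle-y_i\bigr)^2,\qquad F(z)=\max_{z'\in\mathbb{R}^k}\ \operatorname*{median}_{1\le j\le M}\bigl(\ell_j(z)-\ell_j(z')\bigr),$$ where $\max$ is read as a supremum and the median of an even number of values is the mean of the two middle ones. Then with probability at least $1-e^{-c'm}$ the following holds simultaneously for all $\tau$ and all $\hat z\in\mathbb{R}^k$ that minimize $F$ to within additive $\tau$, i.e. $F(\hat z)\le \inf_z F(z)+\tau$: $$\|G(\hat z)-G(z^*)\|^2\le c\,(\sigma^2+\tau).$$ -/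

import Mathlib

open MeasureTheory ProbabilityTheory

noncomputable section

namespace RobustGen

/-- `ℝⁿ` with the Euclidean norm. -/
abbrev Vec (n : ℕ) : Type := EuclideanSpace ℝ (Fin n)

/-! ### ReLU networks -/

/-- Coordinatewise ReLU activation. -/
def relu {n : ℕ} (x : Vec n) : Vec n := WithLp.toLp 2 fun i => max (x i) 0

/-- The affine map `x ↦ W x + v`. -/
def affineMap {p q : ℕ} (W : Matrix (Fin q) (Fin p) ℝ) (v : Fin q → ℝ) (x : Vec p) : Vec q :=
  WithLp.toLp 2 (W.mulVec x.ofLp + v)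

/-- `IsReLUNetwork w d k n G`: the map `G : ℝᵏ → ℝⁿ` is a feedforward network with `d ≥ 1` layers,
all of whose hidden layers have at most `w` nodes. Every hidden layer is an affine map followed by
ReLU; the output layer is an affine map, with or without a ReLU activation. -/
inductive IsReLUNetwork (w : ℕ) : (d k n : ℕ) → (Vec k → Vec n) → Prop
  | reluOutput {k n : ℕ} (W : Matrix (Fin n) (Fin k) ℝ) (v : Fin n → ℝ) :
      IsReLUNetwork w 1 k n (fun z => relu (affineMap W v z))
  | affineOutput {k n : ℕ} (W : Matrix (Fin n) (Fin k) ℝ) (v : Fin n → ℝ) :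
      IsReLUNetwork w 1 k n (fun z => affineMap W v z)
  | hidden {d k p n : ℕ} (hp : p ≤ w) (W : Matrix (Fin p) (Fin k) ℝ) (v : Fin p → ℝ)
      {H : Vec p → Vec n} (hH : IsReLUNetwork w d p n H) :
      IsReLUNetwork w (d + 1) k n (fun z => H (relu (affineMap W v z)))

/-! ### The distribution of the samples -/

/-- A random vector with law `μ` is isotropic: `E[⟨a, u⟩²] = ‖u‖²` for all `u`, that is
`E[a aᵀ] = I`. (For `u ≠ 0` the right side is non-zero, so the square is then integrable.) -/
def IsIsotropic {n : ℕ} (μ : Measure (Vec n)) : Prop :=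
  ∀ u : Vec n, ∫ a, (inner ℝ a u) ^ 2 ∂μ = ‖u‖ ^ 2

/-- A random vector with law `μ` is heavy-tailed with constant `C`:
`(E[⟨a, u⟩⁴])^(1/4) ≤ C (E[⟨a, u⟩²])^(1/2)` for all `u`. The moments are taken in `[0, ∞]`, so
with a finite second moment this includes finiteness of the fourth. -/
def IsHeavyTailed {n : ℕ} (C : ℝ) (μ : Measure (Vec n)) : Prop :=
  ∀ u : Vec n, eLpNorm (fun a : Vec n => inner ℝ a u) 4 μ
    ≤ ENNReal.ofReal C * eLpNorm (fun a : Vec n => inner ℝ a u) 2 μ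

/-- The law `ν` of a real noise variable has mean zero and finite variance `σ²`. -/
structure IsNoise (σ : ℝ) (ν : Measure ℝ) : Prop where
  memLp : MemLp id 2 ν
  mean : ∫ t, t ∂ν = 0
  variance : Var[id; ν] = σ ^ 2

/-- The uncorrupted distribution: the law of `(a, y)` with `y = ⟨a, x⟩ + η`, where `a` has law `μ`
and `η` has law `ν` and is independent of `a`. -/
def cleanLaw {n : ℕ} (x : Vec n) (μ : Measure (Vec n)) (ν : Measure ℝ) : Measure (Vec n × ℝ) :=
  (μ.prod ν).map fun p => (p.1, inner ℝ p.1 x + p.2)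

/-- Huber's contamination model: the mixture `(1 - ε) P + ε Q`. -/
def contaminated {S : Type*} [MeasurableSpace S] (ε : ℝ) (P Q : Measure S) : Measure S :=
  ENNReal.ofReal (1 - ε) • P + ENNReal.ofReal ε • Q

/-! ### The median-of-means tournament objective -/

/-- The `M` sets `B j` are a partition of the sample indices into batches of size `b`. -/
structure IsBatchPartition {m M : ℕ} (b : ℕ) (B : Fin M → Finset (Fin m)) : Prop where
  disjoint : Pairwise fun i j => Disjoint (B i) (B j)
  cover : ∀ i : Fin m, ∃ j : Fin M, i ∈ B j
  card : ∀ j : Fin M, (B j).card = b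

/-- The loss of `z` on the batch `J`: the mean of `(⟨aᵢ, G z⟩ - yᵢ)²` over `i ∈ J`, for the
samples `s i = (aᵢ, yᵢ)`. -/
def batchLoss {k n m : ℕ} (G : Vec k → Vec n) (s : Fin m → Vec n × ℝ) (J : Finset (Fin m))
    (z : Vec k) : ℝ :=
  (1 / (J.card : ℝ)) * ∑ i ∈ J, (inner ℝ (s i).1 (G z) - (s i).2) ^ 2

/-- The median of `M` real numbers: the middle one in increasing order when `M` is odd, the mean
of the two middle ones when `M` is even (and `0` when `M = 0`). -/
def median {M : ℕ} (x : Fin M → ℝ) : ℝ :=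
  if h : 0 < M then
    (x (Tuple.sort x ⟨(M - 1) / 2, by omega⟩) + x (Tuple.sort x ⟨M / 2, by omega⟩)) / 2
  else 0

/-- The tournament objective at `z`: the maximum over `z'` of the median over the batches of the
loss difference `ℓⱼ(z) - ℓⱼ(z')`. -/
def tournament {k n m M : ℕ} (G : Vec k → Vec n) (s : Fin m → Vec n × ℝ)
    (B : Fin M → Finset (Fin m)) (z : Vec k) : ℝ :=
  ⨆ z' : Vec k, median fun j => batchLoss G s (B j) z - batchLoss G s (B j) z'

theorem batchLoss_nonneg {k n m : ℕ} (G : Vec k → Vec n) (s : Fin m → Vec n × ℝ)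
    (J : Finset (Fin m)) (z : Vec k) : 0 ≤ batchLoss G s J z :=
  mul_nonneg (by positivity) (Finset.sum_nonneg fun _ _ => sq_nonneg _)

theorem median_le {M : ℕ} {x : Fin M → ℝ} {r : ℝ} (hr : 0 ≤ r) (h : ∀ j, x j ≤ r) :
    median x ≤ r := by
  unfold median
  split_ifs with hM
  · linarith [h (Tuple.sort x ⟨(M - 1) / 2, by omega⟩), h (Tuple.sort x ⟨M / 2, by omega⟩)]
  · exact hr

/-- The supremum in `tournament` is always over a bounded family, hence a true supremum. -/
theorem bddAbove_tournament {k n m M : ℕ} (G : Vec k → Vec n) (s : Fin m → Vec n × ℝ)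
    (B : Fin M → Finset (Fin m)) (z : Vec k) :
    BddAbove (Set.range fun z' : Vec k =>
      median fun j => batchLoss G s (B j) z - batchLoss G s (B j) z') := by
  refine ⟨∑ j, batchLoss G s (B j) z, ?_⟩
  rintro _ ⟨z', rfl⟩
  refine median_le (Finset.sum_nonneg fun j _ => batchLoss_nonneg G s (B j) z) fun j => ?_
  have h1 := batchLoss_nonneg G s (B j) z'
  have h2 : batchLoss G s (B j) z ≤ ∑ i, batchLoss G s (B i) z :=
    Finset.single_le_sum (f := fun i => batchLoss G s (B i) z)
      (fun i _ => batchLoss_nonneg G s (B i) z) (Finset.mem_univ j)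
  linarith

/-- `z` minimizes the tournament objective to within additive `τ` of the optimum. -/
def IsApproxMinimizer {k n m M : ℕ} (G : Vec k → Vec n) (s : Fin m → Vec n × ℝ)
    (B : Fin M → Finset (Fin m)) (τ : ℝ) (z : Vec k) : Prop :=
  ∀ w : Vec k, tournament G s B z ≤ tournament G s B w + τ

end RobustGen

end

namespace RobustGen

/-! ### Counting the linear pieces of a ReLU network -/

/-- The sets of coordinates on which an affine map is positive, as the argument varies. -/
noncomputable def signPatterns {k p : ℕ} (h : Vec k →ᵃ[ℝ] Vec p) : Finset (Finset (Fin p)) := by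
  classical exact {s | ∃ x, ∀ i, i ∈ s ↔ 0 < h x i}

theorem mem_signPatterns {k p : ℕ} {h : Vec k →ᵃ[ℝ] Vec p} {s : Finset (Fin p)} :
    s ∈ signPatterns h ↔ ∃ x, ∀ i, i ∈ s ↔ 0 < h x i := by
  classical simp [signPatterns]

theorem card_le_of_shatters_signPatterns {k p : ℕ} {h : Vec k →ᵃ[ℝ] Vec p} {s : Finset (Fin p)}
    (hs : (signPatterns h).Shatters s) : s.card ≤ k := by
  classical
  by_contra! hk
  set φ : s → Module.Dual ℝ (Vec k) := fun i =>
    (EuclideanSpace.proj (𝕜 := ℝ) (i : Fin p)).toLinearMap ∘ₗ h.linear with hφ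
  have hdep : ¬ LinearIndependent ℝ φ := fun hli => by
    have := hli.fintype_card_le_finrank
    simp [Subspace.dual_finrank_eq] at this
    omega
  obtain ⟨g, hg, i₀, hi₀⟩ := Fintype.not_linearIndependent_iff.1 hdep
  have hval : ∀ x, ∑ i : s, g i * h x i = ∑ i : s, g i * h 0 i := by
    intro x
    have h1 := congrArg (fun ψ => ψ x) hg
    simp only [LinearMap.sum_apply, LinearMap.smul_apply, smul_eq_mul, LinearMap.zero_apply,
      hφ, LinearMap.comp_apply] at h1
    have h2 : ∀ i : s, h x i = h.linear x i + h 0 i := by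
      intro i
      have := congrFun (AffineMap.decomp h) x
      rw [this]; simp
    simp only [h2, mul_add, Finset.sum_add_distrib]
    have h3 : ∑ i : s, g i * h.linear x i = 0 := by simpa using h1
    rw [h3, zero_add]
  have key : ∀ t : Finset (Fin p), t ⊆ s → ∃ x, ∀ i : s, (i : Fin p) ∈ t ↔ 0 < h x i := by
    intro t ht
    obtain ⟨r, hr, hrt⟩ := hs ht
    obtain ⟨x, hx⟩ := mem_signPatterns.1 hr
    refine ⟨x, fun i => ?_⟩
    rw [← hx i, ← hrt]
    simp
  obtain ⟨x, hx⟩ := key (({i : s | 0 < g i} : Finset s).map ⟨Subtype.val, Subtype.val_injective⟩)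
    (by intro i; simp; tauto)
  obtain ⟨y, hy⟩ := key (({i : s | g i < 0} : Finset s).map ⟨Subtype.val, Subtype.val_injective⟩)
    (by intro i; simp; tauto)
  simp only [Finset.mem_map, Finset.mem_filter, Finset.mem_univ, true_and,
    Function.Embedding.coeFn_mk, SetLike.coe_eq_coe, exists_eq_right] at hx hy
  have hx' : ∀ i : s, 0 ≤ g i * h x i := by
    intro i
    rcases lt_or_ge 0 (g i) with h1 | h1
    · exact (mul_pos h1 ((hx i).1 h1)).le
    · exact mul_nonneg_of_nonpos_of_nonpos h1
        (not_lt.1 fun h2 => absurd ((hx i).2 h2) (not_lt.2 h1))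
  have hy' : ∀ i : s, g i * h y i ≤ 0 := by
    intro i
    rcases lt_or_ge (g i) 0 with h1 | h1
    · exact (mul_neg_of_neg_of_pos h1 ((hy i).1 h1)).le
    · exact mul_nonpos_of_nonneg_of_nonpos h1
        (not_lt.1 fun h2 => absurd ((hy i).2 h2) (not_lt.2 h1))
  have hsum : ∑ i : s, g i * h x i = ∑ i : s, g i * h y i := (hval x).trans (hval y).symm
  rcases lt_or_gt_of_ne hi₀ with h1 | h1
  · have := Finset.sum_lt_sum (fun i _ => hy' i)
      ⟨i₀, Finset.mem_univ _, mul_neg_of_neg_of_pos h1 ((hy i₀).1 h1)⟩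
    have h2 := Finset.sum_nonneg fun i (_ : i ∈ Finset.univ) => hx' i
    simp only [Finset.sum_const_zero] at this
    linarith
  · have := Finset.sum_lt_sum (fun i _ => hx' i)
      ⟨i₀, Finset.mem_univ _, mul_pos h1 ((hx i₀).1 h1)⟩
    have h2 := Finset.sum_nonpos fun i (_ : i ∈ Finset.univ) => hy' i
    simp only [Finset.sum_const_zero] at this
    linarith

theorem sum_choose_le_pow (p k : ℕ) : ∑ j ∈ Finset.Iic k, p.choose j ≤ (p + 1) ^ k := by
  rw [add_pow, Nat.range_succ_eq_Iic]
  refine Finset.sum_le_sum fun j hj => ?_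
  have h1 : 1 ≤ k.choose j := Nat.choose_pos (Finset.mem_Iic.1 hj)
  simpa using (Nat.choose_le_pow p j).trans (Nat.le_mul_of_pos_right _ h1)

/-- An affine map from `ℝᵏ` to `ℝᵖ` has at most `(p + 1)ᵏ` sign patterns. -/
theorem card_signPatterns_le {k p : ℕ} (h : Vec k →ᵃ[ℝ] Vec p) :
    (signPatterns h).card ≤ (p + 1) ^ k := by
  classical
  have hvc : (signPatterns h).vcDim ≤ k := Finset.sup_le fun s hs =>
    card_le_of_shatters_signPatterns (Finset.mem_shatterer.1 hs)
  refine (Finset.card_le_card_shatterer _).trans (Finset.card_shatterer_le_sum_vcDim.trans ?_)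
  rw [Fintype.card_fin]
  exact (Finset.sum_le_sum_of_subset (Finset.Iic_subset_Iic.2 hvc)).trans (sum_choose_le_pow p k)

/-- Keep the coordinates in `s` and set the others to zero. -/
noncomputable def coordMask {p : ℕ} (s : Finset (Fin p)) : Vec p →ₗ[ℝ] Vec p where
  toFun x := WithLp.toLp 2 fun i => if i ∈ s then x i else 0
  map_add' x y := by ext i; by_cases h : i ∈ s <;> simp [h]
  map_smul' c x := by ext i; by_cases h : i ∈ s <;> simp [h]

/-- `affineMap W v` as a bundled affine map. -/
noncomputable def layerAffine {p q : ℕ} (W : Matrix (Fin q) (Fin p) ℝ) (v : Fin q → ℝ) :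
    Vec p →ᵃ[ℝ] Vec q where
  toFun := affineMap W v
  linear :=
    { toFun := fun x => WithLp.toLp 2 (W.mulVec x.ofLp)
      map_add' := fun x y => by ext i; simp [Matrix.mulVec_add]
      map_smul' := fun c x => by ext i; simp [Matrix.mulVec_smul] }
  map_vadd' x y := by
    ext i
    simp [affineMap, Matrix.mulVec_add]
    ring

@[simp] theorem layerAffine_apply {p q : ℕ} (W : Matrix (Fin q) (Fin p) ℝ) (v : Fin q → ℝ)
    (x : Vec p) : layerAffine W v x = affineMap W v x := rfl

theorem exists_affine_pieces_relu {q p : ℕ} (h : Vec q →ᵃ[ℝ] Vec p) :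
    ∃ F : Finset (Vec q →ᵃ[ℝ] Vec p), F.card ≤ (p + 1) ^ q ∧ ∀ x, ∃ f ∈ F, relu (h x) = f x := by
  classical
  refine ⟨(signPatterns h).image fun s => (coordMask s).toAffineMap.comp h,
    Finset.card_image_le.trans (card_signPatterns_le h), fun x => ?_⟩
  refine ⟨_, Finset.mem_image_of_mem _ (a := ({i | 0 < h x i} : Finset (Fin p)))
    (mem_signPatterns.2 ⟨x, by simp⟩), ?_⟩
  ext i
  by_cases hi : 0 < h x i
  · simp [relu, coordMask, hi, hi.le]
  · simp [relu, coordMask, hi, not_lt.1 hi]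

/-- A ReLU network of depth `d`, precomposed with an affine map from `ℝ^q`, coincides at every
point with one of at most `(w + 1) ^ (q d)` affine maps. -/
theorem IsReLUNetwork.exists_affine_pieces_comp {w d k n : ℕ} {G : Vec k → Vec n}
    (hG : IsReLUNetwork w d k n G) (hn : n ≤ w) {q : ℕ} (h : Vec q →ᵃ[ℝ] Vec k) :
    ∃ F : Finset (Vec q →ᵃ[ℝ] Vec n), F.card ≤ (w + 1) ^ (q * d) ∧
      ∀ x, ∃ f ∈ F, G (h x) = f x := by
  classical
  induction hG with
  | @reluOutput k n W v =>
    obtain ⟨F, hF, hF'⟩ := exists_affine_pieces_relu ((layerAffine W v).comp h)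
    exact ⟨F, hF.trans (by rw [mul_one]; gcongr), by simpa using hF'⟩
  | @affineOutput k n W v =>
    exact ⟨{(layerAffine W v).comp h}, by simpa using Nat.one_le_pow _ _ (by omega), by simp⟩
  | @hidden d k p n hp W v H hH ih =>
    obtain ⟨F, hF, hF'⟩ := exists_affine_pieces_relu ((layerAffine W v).comp h)
    choose F₂ hF₂ hF₂' using fun f : Vec q →ᵃ[ℝ] Vec p => ih hn f
    refine ⟨F.biUnion F₂, ?_, fun x => ?_⟩
    · refine (Finset.card_biUnion_le_card_mul F F₂ _ fun f _ => hF₂ f).trans ?_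
      rw [Nat.mul_add, mul_one, pow_add, mul_comm]
      gcongr
      exact hF.trans (by gcongr)
    · obtain ⟨f, hf, hfx⟩ := hF' x
      obtain ⟨f₂, hf₂, hfx₂⟩ := hF₂' f x
      refine ⟨f₂, Finset.mem_biUnion.2 ⟨f, hf, hf₂⟩, ?_⟩
      rw [← hfx₂, ← hfx]
      simp

theorem IsReLUNetwork.exists_affine_pieces {w d k n : ℕ} {G : Vec k → Vec n}
    (hG : IsReLUNetwork w d k n G) (hn : n ≤ w) :
    ∃ F : Finset (Vec k →ᵃ[ℝ] Vec n), F.card ≤ (w + 1) ^ (k * d) ∧ ∀ x, ∃ f ∈ F, G x = f x :=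
  hG.exists_affine_pieces_comp hn (AffineMap.id ℝ (Vec k))

/-! ### Nets for directions -/

theorem exists_int_abs_le_abs_sub_div_le {N : ℕ} (hN : 0 < N) {c : ℝ} (hc : |c| ≤ 1) :
    ∃ z ∈ Finset.Icc (-(N : ℤ)) N, |c - z / N| ≤ 1 / N := by
  have hN' : (0 : ℝ) < N := by exact_mod_cast hN
  obtain ⟨h1, h2⟩ := abs_le.1 hc
  have h3 := Int.floor_le (c * N)
  have h4 := Int.lt_floor_add_one (c * N)
  refine ⟨⌊c * N⌋, Finset.mem_Icc.2 ⟨?_, ?_⟩, ?_⟩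
  · rw [Int.le_floor]; push_cast; nlinarith
  · have : (⌊c * N⌋ : ℝ) ≤ (N : ℤ) := by push_cast; nlinarith
    exact_mod_cast this
  · rw [abs_le]
    have h5 : c - ⌊c * N⌋ / N = (c * N - ⌊c * N⌋) / N := by field_simp
    rw [h5]
    constructor
    · refine le_trans ?_ (div_nonneg (by linarith) hN'.le)
      simp
    · gcongr; linarith

/-- A grid net for the unit sphere of a subspace. -/
theorem exists_sphere_net {E : Type*} [NormedAddCommGroup E] [InnerProductSpace ℝ E]
    (V : Submodule ℝ E) [FiniteDimensional ℝ V] {N : ℕ} (hN : 0 < N) :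
    ∃ T : Finset E, T.card ≤ (2 * N + 1) ^ Module.finrank ℝ V ∧
      ∀ v ∈ V, ‖v‖ = 1 → ∃ t ∈ T, ‖v - t‖ ≤ √(Module.finrank ℝ V) / N := by
  classical
  have hN' : (0 : ℝ) < N := by exact_mod_cast hN
  set D := Module.finrank ℝ V
  let e := stdOrthonormalBasis ℝ V
  refine ⟨(Fintype.piFinset fun _ : Fin D => Finset.Icc (-(N : ℤ)) N).image
    fun c => ((∑ i, ((c i : ℝ) / N) • e i : V) : E), ?_, ?_⟩
  · refine Finset.card_image_le.trans ?_
    rw [Fintype.card_piFinset]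
    simp only [Int.card_Icc, Finset.prod_const, Finset.card_univ, Fintype.card_fin]
    apply le_of_eq
    congr 1
    omega
  · intro v hv hv1
    set v' : V := ⟨v, hv⟩
    have hv1' : ‖v'‖ = 1 := hv1
    have hc : ∀ i, |inner ℝ (e i) v'| ≤ 1 := fun i => by
      have := abs_real_inner_le_norm (e i) v'
      simpa [hv1'] using this
    choose c hcmem hc' using fun i => exists_int_abs_le_abs_sub_div_le hN (hc i)
    refine ⟨_, Finset.mem_image_of_mem _ (Fintype.mem_piFinset.2 hcmem), ?_⟩
    set t : V := ∑ i, ((c i : ℝ) / N) • e i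
    change ‖v' - t‖ ≤ _
    have hsq : ‖v' - t‖ ^ 2 ≤ (√D / N) ^ 2 := by
      rw [← e.sum_sq_norm_inner_right, div_pow, Real.sq_sqrt (by positivity)]
      have h1 : ∀ i, ‖inner ℝ (e i) (v' - t)‖ ^ 2 ≤ (1 / N) ^ 2 := by
        intro i
        have : inner ℝ (e i) t = (c i : ℝ) / N := by
          exact e.orthonormal.inner_right_fintype (fun i => (c i : ℝ) / N) i
        rw [inner_sub_right, this, Real.norm_eq_abs]
        exact pow_le_pow_left₀ (abs_nonneg _) (hc' i) 2
      refine (Finset.sum_le_sum fun i _ => h1 i).trans (le_of_eq ?_)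
      simp [D, div_eq_mul_inv]
    exact le_of_sq_le_sq hsq (by positivity)

/-- A finite net for the directions `(G z - x) / ‖G z - x‖`, for a ReLU network `G`. -/
theorem IsReLUNetwork.exists_direction_net {w d k n : ℕ} {G : Vec k → Vec n}
    (hG : IsReLUNetwork w d k n G) (hn : n ≤ w) (x : Vec n) {N : ℕ} (hN : 0 < N) :
    ∃ T : Finset (Vec n), T.card ≤ (w + 1) ^ (k * d) * (2 * N + 1) ^ (k + 1) ∧
      ∀ z, G z ≠ x → ∃ t ∈ T, ‖‖G z - x‖⁻¹ • (G z - x) - t‖ ≤ √n / N := by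
  classical
  obtain ⟨F, hF, hF'⟩ := hG.exists_affine_pieces hn
  let V : (Vec k →ᵃ[ℝ] Vec n) → Submodule ℝ (Vec n) := fun f =>
    LinearMap.range f.linear ⊔ Submodule.span ℝ {f 0 - x}
  have hV : ∀ f, Module.finrank ℝ (V f) ≤ k + 1 := fun f => by
    refine (Submodule.finrank_add_le_finrank_add_finrank _ _).trans ?_
    gcongr
    · simpa using LinearMap.finrank_range_le f.linear
    · simpa using finrank_span_le_card (R := ℝ) ({f 0 - x} : Set (Vec n))
  have hVn : ∀ f, Module.finrank ℝ (V f) ≤ n := fun f => by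
    simpa using Submodule.finrank_le (V f)
  choose T hT hT' using fun f => exists_sphere_net (V f) hN
  refine ⟨F.biUnion T, ?_, fun z hz => ?_⟩
  · refine (Finset.card_biUnion_le_card_mul F T ((2 * N + 1) ^ (k + 1)) fun f _ =>
      (hT f).trans ?_).trans (by gcongr)
    exact Nat.pow_le_pow_right (by omega) (hV f)
  · obtain ⟨f, hf, hfz⟩ := hF' z
    have hmem : G z - x ∈ V f := by
      have h1 : G z - x = f.linear z + (f 0 - x) := by
        rw [hfz, congrFun (AffineMap.decomp f) z]; simp; abel
      rw [h1]
      exact Submodule.add_mem_sup (LinearMap.mem_range_self _ _)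
        (Submodule.mem_span_singleton_self _)
    have hne : ‖G z - x‖ ≠ 0 := norm_ne_zero_iff.2 (sub_ne_zero.2 hz)
    obtain ⟨t, ht, htz⟩ := hT' f _ ((V f).smul_mem ‖G z - x‖⁻¹ hmem)
      (by rw [norm_smul, norm_inv, norm_norm, inv_mul_cancel₀ hne])
    refine ⟨t, Finset.mem_biUnion.2 ⟨f, hf, ht⟩, htz.trans ?_⟩
    gcongr
    exact_mod_cast hVn f

/-! ### Moment bounds for a single sample -/

/-- **Markov's inequality** for a multiple of the mean. -/
theorem measureReal_mul_integral_lt_le {α : Type*} [MeasurableSpace α] {μ : Measure α}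
    [IsProbabilityMeasure μ] {f : α → ℝ} (hf : ∀ a, 0 ≤ f a) (hint : Integrable f μ)
    {L : ℝ} (hL : 0 < L) : μ.real {a | L * ∫ x, f x ∂μ < f a} ≤ 1 / L := by
  rcases (integral_nonneg hf : 0 ≤ ∫ x, f x ∂μ).eq_or_lt with h0 | h0
  · have h1 : f =ᵐ[μ] 0 := (integral_eq_zero_iff_of_nonneg hf hint).1 h0.symm
    have h2 : μ {a | L * ∫ x, f x ∂μ < f a} = 0 := by
      rw [← h0, mul_zero]
      exact measure_mono_null (fun a (ha : 0 < f a) => ha.ne') (ae_iff.1 h1)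
    rw [measureReal_def, h2]
    simpa using hL.le
  · have hM := mul_meas_ge_le_integral_of_nonneg (ae_of_all μ hf) hint (L * ∫ x, f x ∂μ)
    have hle : μ.real {a | L * ∫ x, f x ∂μ < f a} ≤ μ.real {a | L * ∫ x, f x ∂μ ≤ f a} :=
      measureReal_mono fun a (ha : L * ∫ x, f x ∂μ < f a) => ha.le
    rw [le_div_iff₀ hL]
    have h1 := mul_le_mul_of_nonneg_left hle (mul_pos hL h0).le
    have h2 : (μ.real {a | L * ∫ x, f x ∂μ < f a} * L) * ∫ x, f x ∂μ ≤ 1 * ∫ x, f x ∂μ := by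
      linarith
    exact le_of_mul_le_mul_right h2 h0

section Moments

variable {n : ℕ} {μ : Measure (Vec n)} {C : ℝ}

theorem IsIsotropic.integrable_sq (h : IsIsotropic μ) (u : Vec n) :
    Integrable (fun a => (inner ℝ a u : ℝ) ^ 2) μ := by
  by_cases hu : u = 0
  · simp [hu]
  · by_contra hI
    have h1 := h u
    rw [integral_undef hI] at h1
    exact hu (norm_eq_zero.1 (pow_eq_zero_iff two_ne_zero |>.1 h1.symm))

theorem IsIsotropic.memLp_two (h : IsIsotropic μ) (u : Vec n) :
    MemLp (fun a => (inner ℝ a u : ℝ)) 2 μ :=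
  (memLp_two_iff_integrable_sq (by fun_prop)).2 (h.integrable_sq u)

theorem IsIsotropic.eLpNorm_two (h : IsIsotropic μ) (u : Vec n) :
    eLpNorm (fun a => (inner ℝ a u : ℝ)) 2 μ = ENNReal.ofReal ‖u‖ := by
  rw [(h.memLp_two u).eLpNorm_eq_integral_rpow_norm two_ne_zero ENNReal.ofNat_ne_top]
  congr 1
  have : ∀ a : Vec n, ‖(inner ℝ a u : ℝ)‖ ^ (2 : ENNReal).toReal = (inner ℝ a u : ℝ) ^ 2 := by
    intro a
    simp
  simp only [this, h u]
  rw [ENNReal.toReal_ofNat, ← one_div, ← Real.sqrt_eq_rpow, Real.sqrt_sq (norm_nonneg _)]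

theorem IsHeavyTailed.integrable_pow_four (hC : 0 ≤ C) (h : IsIsotropic μ)
    (hh : IsHeavyTailed C μ) (u : Vec n) :
    Integrable (fun a => (inner ℝ a u : ℝ) ^ 4) μ ∧
      ∫ a, (inner ℝ a u : ℝ) ^ 4 ∂μ ≤ C ^ 4 * ‖u‖ ^ 4 := by
  have h1 := hh u
  rw [h.eLpNorm_two, ← ENNReal.ofReal_mul hC] at h1
  have hmem : MemLp (fun a => (inner ℝ a u : ℝ)) 4 μ :=
    ⟨by fun_prop, h1.trans_lt ENNReal.ofReal_lt_top⟩
  have h2 : ∀ a : Vec n, ‖(inner ℝ a u : ℝ)‖ ^ (4 : ENNReal).toReal = (inner ℝ a u : ℝ) ^ 4 := by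
    intro a
    have := Real.rpow_natCast ‖(inner ℝ a u : ℝ)‖ 4
    push_cast at this
    rw [ENNReal.toReal_ofNat, this, Real.norm_eq_abs, Even.pow_abs (by decide)]
  have hint := hmem.integrable_norm_rpow (by norm_num) ENNReal.ofNat_ne_top
  rw [hmem.eLpNorm_eq_integral_rpow_norm (by norm_num) ENNReal.ofNat_ne_top] at h1
  simp only [h2] at h1 hint
  refine ⟨hint, ?_⟩
  rw [ENNReal.ofReal_le_ofReal_iff (by positivity), ENNReal.toReal_ofNat] at h1
  have hnn : 0 ≤ ∫ a, (inner ℝ a u : ℝ) ^ 4 ∂μ := integral_nonneg fun a => by positivity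
  have h3 := pow_le_pow_left₀ (by positivity) h1 4
  rw [← Real.rpow_natCast (_ ^ _) 4, ← Real.rpow_mul hnn, mul_pow] at h3
  norm_num at h3
  exact h3

/-- A small-ball estimate, of Paley–Zygmund type. -/
theorem IsHeavyTailed.le_measureReal_half_norm_le [IsProbabilityMeasure μ] (hC : 0 < C)
    (h : IsIsotropic μ) (hh : IsHeavyTailed C μ) {u : Vec n} (hu : u ≠ 0) :
    1 / (2 * C ^ 4) ≤ μ.real {a | ‖u‖ / 2 ≤ |inner ℝ a u|} := by
  set A : Set (Vec n) := {a | ‖u‖ / 2 ≤ |inner ℝ a u|} with hA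
  have hAm : MeasurableSet A := measurableSet_le (by fun_prop) (by fun_prop)
  have hs : 0 < ‖u‖ := norm_pos_iff.2 hu
  obtain ⟨hint, h4⟩ := hh.integrable_pow_four hC.le h u
  set θ := C ^ 4 * ‖u‖ ^ 2 with hθ
  have hθ0 : 0 < θ := by positivity
  have hpt : ∀ a : Vec n, (inner ℝ a u : ℝ) ^ 2 ≤
      ‖u‖ ^ 2 / 4 + (1 / (4 * θ)) * (inner ℝ a u : ℝ) ^ 4 + A.indicator (fun _ => θ) a := by
    intro a
    set r : ℝ := inner ℝ a u with hr
    by_cases ha : a ∈ A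
    · rw [Set.indicator_of_mem ha]
      have h5 : 0 ≤ (1 / (4 * θ)) * (r ^ 2 - 2 * θ) ^ 2 := by positivity
      have h6 : (1 / (4 * θ)) * (r ^ 2 - 2 * θ) ^ 2 = (1 / (4 * θ)) * r ^ 4 - r ^ 2 + θ := by
        field_simp; ring
      nlinarith [sq_nonneg ‖u‖]
    · rw [Set.indicator_of_notMem ha]
      have h5 : |r| < ‖u‖ / 2 := not_le.1 ha
      have h6 : |r| ^ 2 ≤ (‖u‖ / 2) ^ 2 := pow_le_pow_left₀ (abs_nonneg _) h5.le 2
      rw [sq_abs] at h6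
      have h7 : 0 ≤ (1 / (4 * θ)) * r ^ 4 := by positivity
      linarith
  have hi1 : Integrable (fun a : Vec n => (1 / (4 * θ)) * (inner ℝ a u : ℝ) ^ 4) μ :=
    hint.const_mul _
  have hi2 : Integrable (A.indicator fun _ : Vec n => θ) μ := (integrable_const θ).indicator hAm
  have hI := integral_mono (h.integrable_sq u) (((integrable_const _).add hi1).add hi2) hpt
  rw [h u, integral_add' ((integrable_const _).add hi1) hi2,
    integral_add' (integrable_const _) hi1, integral_const_mul, integral_indicator_const _ hAm] at hI
  simp only [integral_const, probReal_univ, smul_eq_mul] at hI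
  have h8 : (1 / (4 * θ)) * ∫ a, (inner ℝ a u : ℝ) ^ 4 ∂μ ≤ ‖u‖ ^ 2 / 4 := by
    refine (mul_le_mul_of_nonneg_left h4 (by positivity)).trans (le_of_eq ?_)
    rw [hθ]; field_simp
  have h9 : ‖u‖ ^ 2 / 2 ≤ μ.real A * θ := by linarith
  rw [div_le_iff₀ (by positivity)]
  rw [hθ] at h9
  have h10 : 0 < ‖u‖ ^ 2 := by positivity
  nlinarith

theorem IsIsotropic.measureReal_norm_sq_le [IsProbabilityMeasure μ] (h : IsIsotropic μ)
    (hn : 0 < n) {L : ℝ} (hL : 0 < L) : μ.real {a | L * n < ‖a‖ ^ 2} ≤ 1 / L := by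
  have hn' : (0 : ℝ) < n := by exact_mod_cast hn
  have hsum : ∀ a : Vec n, ‖a‖ ^ 2 =
      ∑ i, (inner ℝ a (EuclideanSpace.basisFun (Fin n) ℝ i) : ℝ) ^ 2 := by
    intro a
    rw [← (EuclideanSpace.basisFun (Fin n) ℝ).sum_sq_norm_inner_left a]
    simp
  have hint : Integrable (fun a : Vec n => ‖a‖ ^ 2) μ := by
    simp only [hsum]
    exact integrable_finsetSum _ fun i _ => h.integrable_sq _
  have hval : ∫ a, ‖a‖ ^ 2 ∂μ = n := by
    simp only [hsum]
    rw [integral_finsetSum _ fun i _ => h.integrable_sq _]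
    simp only [h _]
    simp
  simpa only [hval] using
    measureReal_mul_integral_lt_le (fun a : Vec n => sq_nonneg ‖a‖) hint hL

theorem IsNoise.measureReal_sq_le {σ : ℝ} {ν : Measure ℝ} [IsProbabilityMeasure ν]
    (h : IsNoise σ ν) {L : ℝ} (hL : 0 < L) : ν.real {t | L * σ ^ 2 < t ^ 2} ≤ 1 / L := by
  have hint : Integrable (fun t : ℝ => t ^ 2) ν := h.memLp.integrable_sq
  have hval : ∫ t, t ^ 2 ∂ν = σ ^ 2 := by
    rw [← h.variance, variance_of_integral_eq_zero aemeasurable_id (by simpa using h.mean)]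
    simp
  simpa only [hval] using measureReal_mul_integral_lt_le (fun t : ℝ => sq_nonneg t) hint hL

end Moments

/-! ### The contaminated law of a single sample -/

theorem contaminated_apply_le {S : Type*} [MeasurableSpace S] {ε : ℝ} (hε : 0 ≤ ε)
    (P Q : Measure S) [IsProbabilityMeasure Q] (A : Set S) :
    contaminated ε P Q A ≤ P A + ENNReal.ofReal ε := by
  simp only [contaminated, Measure.coe_add, Measure.coe_smul, Pi.add_apply, Pi.smul_apply,
    smul_eq_mul]
  gcongr
  · refine (mul_le_mul_left (ENNReal.ofReal_le_ofReal (by linarith : 1 - ε ≤ 1)) _).trans ?_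
    simp
  · exact (mul_le_mul_right prob_le_one _).trans (by simp)

section SampleEvents

variable {n : ℕ}

/-- The samples that give no useful lower bound for `⟨a, t⟩` that is stable under perturbing `t`. -/
def uninformative (L : ℝ) (t : Vec n) : Set (Vec n × ℝ) :=
  {s | ¬ (‖t‖ / 2 ≤ |inner ℝ s.1 t| ∧ ‖s.1‖ ^ 2 ≤ L * n)}

/-- The samples with large noise relative to the signal `x`. -/
def noisy (L σ : ℝ) (x : Vec n) : Set (Vec n × ℝ) :=
  {s | L * σ ^ 2 < (s.2 - inner ℝ s.1 x) ^ 2}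

theorem measurableSet_uninformative (L : ℝ) (t : Vec n) : MeasurableSet (uninformative L t) := by
  refine MeasurableSet.compl
    (s := {s : Vec n × ℝ | ‖t‖ / 2 ≤ |inner ℝ s.1 t|} ∩ {s | ‖s.1‖ ^ 2 ≤ L * n})
    (MeasurableSet.inter (measurableSet_le ?_ ?_) (measurableSet_le ?_ ?_)) <;> fun_prop

theorem measurableSet_noisy (L σ : ℝ) (x : Vec n) : MeasurableSet (noisy L σ x) :=
  measurableSet_lt (by fun_prop) (by fun_prop)

variable {μ : Measure (Vec n)} [IsProbabilityMeasure μ] {ν : Measure ℝ} [IsProbabilityMeasure ν]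
  {C ε σ L : ℝ} {x t : Vec n}

theorem measurable_cleanLaw_map (x : Vec n) :
    Measurable fun p : Vec n × ℝ => (p.1, inner ℝ p.1 x + p.2) := by fun_prop

theorem cleanLaw_uninformative_le (hC : 0 < C) (h : IsIsotropic μ) (hh : IsHeavyTailed C μ)
    (hn : 0 < n) (hL : 0 < L) (ht : t ≠ 0) :
    cleanLaw x μ ν (uninformative L t) ≤ ENNReal.ofReal (1 - 1 / (2 * C ^ 4) + 1 / L) := by
  rw [cleanLaw, Measure.map_apply (measurable_cleanLaw_map x) (measurableSet_uninformative L t)]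
  set A : Set (Vec n) := {a | ‖t‖ / 2 ≤ |inner ℝ a t|}
  have hAm : MeasurableSet A := measurableSet_le (by fun_prop) (by fun_prop)
  have hpre : (fun p : Vec n × ℝ => (p.1, inner ℝ p.1 x + p.2)) ⁻¹' uninformative L t ⊆
      (Aᶜ ∪ {a | L * n < ‖a‖ ^ 2}) ×ˢ Set.univ := by
    intro p hp
    simp only [uninformative, Set.mem_preimage, Set.mem_ofPred_eq, not_and_or, not_le] at hp
    refine ⟨?_, trivial⟩
    rcases hp with hp | hp
    · exact Or.inl (not_le.2 hp)
    · exact Or.inr hp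
  refine (measure_mono hpre).trans ?_
  rw [Measure.prod_prod, measure_univ, mul_one, ← ofReal_measureReal]
  refine ENNReal.ofReal_le_ofReal ((measureReal_union_le _ _).trans ?_)
  have h1 := hh.le_measureReal_half_norm_le hC h ht
  have h2 := h.measureReal_norm_sq_le hn hL
  rw [probReal_compl_eq_one_sub hAm]
  linarith

theorem cleanLaw_noisy_le (h : IsNoise σ ν) (hL : 0 < L) :
    cleanLaw x μ ν (noisy L σ x) ≤ ENNReal.ofReal (1 / L) := by
  rw [cleanLaw, Measure.map_apply (measurable_cleanLaw_map x) (measurableSet_noisy L σ x)]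
  have hpre : (fun p : Vec n × ℝ => (p.1, inner ℝ p.1 x + p.2)) ⁻¹' noisy L σ x =
      Set.univ ×ˢ {t | L * σ ^ 2 < t ^ 2} := by
    ext p
    simp [noisy]
  rw [hpre, Measure.prod_prod, measure_univ, one_mul, ← ofReal_measureReal]
  exact ENNReal.ofReal_le_ofReal (h.measureReal_sq_le hL)

end SampleEvents

/-! ### Independent batches -/

section Batches

variable {Ω S ι κ : Type*} [MeasurableSpace Ω] [MeasurableSpace S] {Pr : Measure Ω}
  {X : ι → Ω → S}

theorem measure_biInter_restrict_eq_prod [IsProbabilityMeasure Pr] (hX : iIndepFun X Pr)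
    (hXm : ∀ i, AEMeasurable (X i) Pr)
    {B : κ → Finset ι} (hB : Pairwise fun i j => Disjoint (B i) (B j))
    {E : ∀ j, Set (B j → S)} (hE : ∀ j, MeasurableSet (E j)) (T : Finset κ) :
    Pr (⋂ j ∈ T, (fun ω (i : B j) => X i ω) ⁻¹' E j) =
      ∏ j ∈ T, Pr ((fun ω (i : B j) => X i ω) ⁻¹' E j) := by
  classical
  induction T using Finset.induction_on with
  | empty => simp
  | @insert j₀ T hj₀ ih =>
    rw [Finset.prod_insert hj₀, Finset.set_biInter_insert, ← ih]
    have hdisj : Disjoint (B j₀) (T.biUnion B) :=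
      (Finset.disjoint_biUnion_right _ _ _).2 fun j hj => hB (by rintro rfl; exact hj₀ hj)
    have hind := hX.indepFun_finset₀ (B j₀) (T.biUnion B) hdisj hXm
    let E' : Set (T.biUnion B → S) := ⋂ j : T,
      (fun y (i : B j) => y ⟨i, Finset.mem_biUnion.2 ⟨j, j.2, i.2⟩⟩) ⁻¹' E j
    have hE' : MeasurableSet E' := MeasurableSet.iInter fun j =>
      (measurable_pi_lambda _ fun i => measurable_pi_apply _) (hE j)
    have hpre : (⋂ j ∈ T, (fun ω (i : B j) => X i ω) ⁻¹' E j) =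
        (fun ω (i : T.biUnion B) => X i ω) ⁻¹' E' := by
      ext ω
      simp [E']
    rw [hpre, hind.measure_inter_preimage_eq_mul _ _ (hE j₀) hE']

/-- A batch `J` is bad if all its samples lie in `U` or some sample lies in `N`. -/
def badBatch (U N : Set S) (J : Finset ι) : Set (ι → S) :=
  {s | (∀ i ∈ J, s i ∈ U) ∨ ∃ i ∈ J, s i ∈ N}

theorem measure_badBatch_le (hX : iIndepFun X Pr) {ρ : Measure S} (hρ : ∀ i, HasLaw (X i) ρ Pr)
    {U N : Set S} (hU : MeasurableSet U) (hN : MeasurableSet N) (J : Finset ι) :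
    Pr {ω | (fun i => X i ω) ∈ badBatch U N J} ≤ ρ U ^ J.card + J.card * ρ N := by
  have hset : {ω | (fun i => X i ω) ∈ badBatch U N J} =
      (⋂ i ∈ J, X i ⁻¹' U) ∪ ⋃ i ∈ J, X i ⁻¹' N := by
    ext ω
    simp [badBatch]
  have hlaw : ∀ {A : Set S}, MeasurableSet A → ∀ i, Pr (X i ⁻¹' A) = ρ A := fun hA i =>
    (hρ i).measure_eq (p := (· ∈ _)) hA
  rw [hset]
  refine (measure_union_le _ _).trans (add_le_add ?_ ?_)
  · rw [hX.measure_inter_preimage_eq_mul J (fun i _ => hU)]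
    simp [hlaw hU]
  · refine (measure_biUnion_finset_le _ _).trans ?_
    simp [hlaw hN]

/-- If each of `M` disjoint batches is bad with probability at most `r²`, then half of them are bad
with probability at most `(2 r) ^ M`. -/
theorem measure_half_badBatch_le [IsProbabilityMeasure Pr] {M : ℕ} (hX : iIndepFun X Pr)
    {ρ : Measure S} (hρ : ∀ i, HasLaw (X i) ρ Pr) {U N : Set S} (hU : MeasurableSet U) (hN : MeasurableSet N)
    {B : Fin M → Finset ι} (hB : Pairwise fun i j => Disjoint (B i) (B j))
    {r : ENNReal} (hr1 : r ≤ 1)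
    (hr : ∀ j, Pr {ω | (fun i => X i ω) ∈ badBatch U N (B j)} ≤ r ^ 2) :
    Pr {ω | ∃ T : Finset (Fin M), M ≤ 2 * T.card ∧
      ∀ j ∈ T, (fun i => X i ω) ∈ badBatch U N (B j)} ≤ (2 * r) ^ M := by
  classical
  have hone : ∀ T ∈ (Finset.univ : Finset (Finset (Fin M))).filter (M ≤ 2 * ·.card),
      Pr (⋂ j ∈ T, {ω | (fun i => X i ω) ∈ badBatch U N (B j)}) ≤ r ^ M := by
    intro T hT
    let E : ∀ j, Set (B j → S) := fun j => {y | (∀ i, y i ∈ U) ∨ ∃ i, y i ∈ N}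
    have hE : ∀ j, MeasurableSet (E j) := fun j => by
      have : E j = (⋂ i, (fun y => y i) ⁻¹' U) ∪ ⋃ i, (fun y => y i) ⁻¹' N := by
        ext y; simp [E]
      rw [this]
      exact (MeasurableSet.iInter fun i => (measurable_pi_apply i) hU).union
        (MeasurableSet.iUnion fun i => (measurable_pi_apply i) hN)
    have hpre : ∀ j, {ω | (fun i => X i ω) ∈ badBatch U N (B j)} =
        (fun ω (i : B j) => X i ω) ⁻¹' E j := fun j => by
      ext ω
      simp [E, badBatch]
    simp only [hpre] at hr ⊢
    rw [measure_biInter_restrict_eq_prod hX (fun i => (hρ i).aemeasurable) hB hE]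
    refine (Finset.prod_le_prod' fun j _ => hr j).trans ?_
    rw [Finset.prod_const, ← pow_mul]
    exact pow_le_pow_right_of_le_one' hr1 (Finset.mem_filter.1 hT).2
  have hsub : {ω | ∃ T : Finset (Fin M), M ≤ 2 * T.card ∧
      ∀ j ∈ T, (fun i => X i ω) ∈ badBatch U N (B j)} ⊆
      ⋃ T ∈ (Finset.univ : Finset (Finset (Fin M))).filter (M ≤ 2 * ·.card),
        ⋂ j ∈ T, {ω | (fun i => X i ω) ∈ badBatch U N (B j)} := by
    rintro ω ⟨T, hT, hω⟩
    simp only [Set.mem_iUnion, Finset.mem_filter, Finset.mem_univ, true_and]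
    exact ⟨T, hT, by simpa using hω⟩
  refine (measure_mono hsub).trans ((measure_biUnion_finset_le _ _).trans
    ((Finset.sum_le_sum hone).trans ?_))
  rw [Finset.sum_const, nsmul_eq_mul, mul_pow]
  gcongr
  have : ((Finset.univ : Finset (Finset (Fin M))).filter (M ≤ 2 * ·.card)).card ≤ 2 ^ M :=
    (Finset.card_filter_le _ _).trans (by simp)
  exact_mod_cast this

end Batches

/-! ### Medians and the tournament -/

theorem median_le_of_lt_card {M : ℕ} {x : Fin M → ℝ} {r : ℝ}
    (h : M < 2 * (Finset.univ.filter fun j => x j ≤ r).card) : median x ≤ r := by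
  have hM : 0 < M := by
    by_contra h0
    obtain rfl : M = 0 := by omega
    simp at h
  have hcard : (Finset.univ.filter fun j => (x ∘ Tuple.sort x) j ≤ r).card =
      (Finset.univ.filter fun j => x j ≤ r).card :=
    Finset.card_equiv (Tuple.sort x) (by simp)
  have key : ∀ j : Fin M, (j : ℕ) ≤ M / 2 → x (Tuple.sort x j) ≤ r := fun j hj =>
    (Tuple.lt_card_le_iff_apply_le_of_monotone (Tuple.monotone_sort x)).1 (by omega)
  unfold median
  rw [dif_pos hM]
  linarith [key ⟨(M - 1) / 2, by omega⟩ (by simp; omega), key ⟨M / 2, by omega⟩ le_rfl]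

theorem le_median_of_lt_card {M : ℕ} {x : Fin M → ℝ} {r : ℝ}
    (h : M < 2 * (Finset.univ.filter fun j => r ≤ x j).card) : r ≤ median x := by
  have hM : 0 < M := by
    by_contra h0
    obtain rfl : M = 0 := by omega
    simp at h
  have hcard : (Finset.univ.filter fun j => (x ∘ Tuple.sort x) j < r).card =
      (Finset.univ.filter fun j => x j < r).card :=
    Finset.card_equiv (Tuple.sort x) (by simp)
  have hcompl : (Finset.univ.filter fun j => r ≤ x j).card +
      (Finset.univ.filter fun j => x j < r).card = M := by
    simpa using Finset.card_filter_add_card_filter_not (s := Finset.univ) fun j => r ≤ x j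
  have key : ∀ j : Fin M, (M - 1) / 2 ≤ (j : ℕ) → r ≤ x (Tuple.sort x j) := fun j hj => by
    by_contra! hlt
    have := (Tuple.lt_card_lt_iff_apply_lt_of_monotone (Tuple.monotone_sort x)).2 hlt
    omega
  unfold median
  rw [dif_pos hM]
  linarith [key ⟨(M - 1) / 2, by omega⟩ le_rfl, key ⟨M / 2, by omega⟩ (by simp; omega)]

section Tournament

variable {k n m M : ℕ} {G : Vec k → Vec n} {s : Fin m → Vec n × ℝ} {B : Fin M → Finset (Fin m)}

theorem IsApproxMinimizer.nonneg {τ : ℝ} {z : Vec k} (h : IsApproxMinimizer G s B τ z) : 0 ≤ τ := by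
  have := h z
  linarith

/-- If the losses of more than half of the batches grow quadratically around `zstar` up to an error
`δ`, then approximate minimizers of the tournament are close to `zstar`. -/
theorem IsApproxMinimizer.mul_norm_sq_le {zstar zhat : Vec k} {α δ τ : ℝ} (hα : 0 ≤ α)
    (hgrow : ∀ z, M < 2 * (Finset.univ.filter fun j =>
      α * ‖G z - G zstar‖ ^ 2 - δ ≤ batchLoss G s (B j) z - batchLoss G s (B j) zstar).card)
    (h : IsApproxMinimizer G s B τ zhat) : α * ‖G zhat - G zstar‖ ^ 2 ≤ 2 * δ + τ := by
  have h1 : α * ‖G zhat - G zstar‖ ^ 2 - δ ≤ tournament G s B zhat :=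
    (le_median_of_lt_card (hgrow zhat)).trans (le_ciSup (bddAbove_tournament G s B zhat) zstar)
  have h2 : tournament G s B zstar ≤ δ := by
    refine ciSup_le fun z => median_le_of_lt_card ((hgrow z).trans_le ?_)
    refine Nat.mul_le_mul_left 2 (Finset.card_le_card fun j => ?_)
    simp only [Finset.mem_filter, Finset.mem_univ, true_and]
    intro hj
    nlinarith [sq_nonneg ‖G z - G zstar‖]
  linarith [h zstar]

theorem le_batchLoss_sub {J : Finset (Fin m)} {z zstar : Vec k} {r κ : ℝ} (i₀ : Fin m)
    (hi₀ : i₀ ∈ J) (hr : r ≤ (inner ℝ (s i₀).1 (G z - G zstar)) ^ 2)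
    (hκ : ∀ i ∈ J, ((s i).2 - inner ℝ (s i).1 (G zstar)) ^ 2 ≤ κ) :
    r / (2 * J.card) - 2 * κ ≤ batchLoss G s J z - batchLoss G s J zstar := by
  have hJ : (0 : ℝ) < J.card := by exact_mod_cast Finset.card_pos.2 ⟨i₀, hi₀⟩
  have hterm : ∀ i ∈ J, (inner ℝ (s i).1 (G z - G zstar)) ^ 2 / 2 - 2 * κ ≤
      (inner ℝ (s i).1 (G z) - (s i).2) ^ 2 - (inner ℝ (s i).1 (G zstar) - (s i).2) ^ 2 := by
    intro i hi
    have h1 := hκ i hi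
    rw [inner_sub_right]
    nlinarith [sq_nonneg (inner ℝ (s i).1 (G z) - inner ℝ (s i).1 (G zstar)
      - 2 * ((s i).2 - inner ℝ (s i).1 (G zstar)))]
  have hsum := Finset.sum_le_sum hterm
  have hsingle := Finset.single_le_sum
    (f := fun i => (inner ℝ (s i).1 (G z - G zstar) : ℝ) ^ 2 / 2) (fun i _ => by positivity) hi₀
  simp only [Finset.sum_sub_distrib, Finset.sum_const, nsmul_eq_mul] at hsum
  unfold batchLoss
  rw [← mul_sub]
  calc r / (2 * J.card) - 2 * κ = 1 / J.card * (r / 2 - J.card * (2 * κ)) := by field_simp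
    _ ≤ _ := mul_le_mul_of_nonneg_left (by linarith) (by positivity)

theorem le_abs_inner_of_net {a u t : Vec n} {L : ℝ} {N : ℕ} (hn : 0 < n) (hL : 1 ≤ L)
    (hN : 8 * √L * n ≤ N) (hu : u ≠ 0) (ht : ‖‖u‖⁻¹ • u - t‖ ≤ √n / N)
    (hat : ‖t‖ / 2 ≤ |inner ℝ a t|) (ha : ‖a‖ ^ 2 ≤ L * n) :
    t ≠ 0 ∧ ‖u‖ / 8 ≤ |inner ℝ a u| := by
  have hn1 : (1 : ℝ) ≤ n := by exact_mod_cast hn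
  have hLs : 1 ≤ √L := Real.one_le_sqrt.2 hL
  have hns : 1 ≤ √n := Real.one_le_sqrt.2 hn1
  have hN0 : (0 : ℝ) < N := lt_of_lt_of_le (by positivity) hN
  have hu0 : 0 < ‖u‖ := norm_pos_iff.2 hu
  set v := ‖u‖⁻¹ • u with hv
  have hv1 : ‖v‖ = 1 := by rw [hv, norm_smul, norm_inv, norm_norm, inv_mul_cancel₀ hu0.ne']
  have hsn : √n * √n = n := Real.mul_self_sqrt (by positivity)
  have hδ : √n / N ≤ 1 / 8 := by
    rw [div_le_iff₀ hN0]
    nlinarith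
  have ha' : ‖a‖ ≤ √L * √n := by
    rw [← Real.sqrt_mul (by linarith)]
    exact Real.le_sqrt_of_sq_le ha
  have haδ : ‖a‖ * ‖v - t‖ ≤ 1 / 8 := by
    calc ‖a‖ * ‖v - t‖ ≤ (√L * √n) * (√n / N) := by gcongr
      _ = √L * (√n * √n) / N := by ring
      _ = √L * n / N := by rw [hsn]
      _ ≤ 1 / 8 := by rw [div_le_iff₀ hN0]; linarith
  have htn : 7 / 8 ≤ ‖t‖ := by
    have := norm_sub_norm_le v t
    linarith
  have hav : 1 / 8 ≤ |inner ℝ a v| := by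
    have h1 := abs_real_inner_le_norm a (v - t)
    rw [inner_sub_right] at h1
    have h2 := abs_sub_abs_le_abs_sub (inner ℝ a t : ℝ) (inner ℝ a v)
    rw [abs_sub_comm] at h2
    linarith
  refine ⟨norm_pos_iff.1 (by linarith), ?_⟩
  rw [hv, inner_smul_right, abs_mul, abs_inv, abs_norm] at hav
  calc ‖u‖ / 8 = ‖u‖ * (1 / 8) := by ring
    _ ≤ ‖u‖ * (‖u‖⁻¹ * |inner ℝ a u|) := by gcongr
    _ = _ := by field_simp

theorem IsBatchPartition.mul_eq {b : ℕ} (hB : IsBatchPartition b B) : m = b * M := by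
  classical
  have h1 : (Finset.univ : Finset (Fin m)) = Finset.univ.biUnion B := by
    ext i
    simpa using hB.cover i
  have h2 := congrArg Finset.card h1
  rw [Finset.card_biUnion fun i _ j _ hij => hB.disjoint hij] at h2
  simpa [hB.card, mul_comm] using h2

theorem IsReLUNetwork.one_le_depth {w d k n : ℕ} {G : Vec k → Vec n}
    (hG : IsReLUNetwork w d k n G) : 1 ≤ d := by
  cases hG <;> omega

theorem lt_card_quadratic_growth {b : ℕ} (hB : IsBatchPartition b B) (hb : 0 < b) (hM : 0 < M)
    {T : Finset (Vec n)} {N : ℕ} {L L' σ : ℝ} {zstar : Vec k} (hn : 0 < n) (hL : 1 ≤ L)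
    (hL' : 0 ≤ L') (hN : 8 * √L * n ≤ N)
    (hT : ∀ z, G z ≠ G zstar → ∃ t ∈ T, ‖‖G z - G zstar‖⁻¹ • (G z - G zstar) - t‖ ≤ √n / N)
    (hgood : ∀ t ∈ T, t ≠ 0 → ¬ ∃ S : Finset (Fin M), M ≤ 2 * S.card ∧
      ∀ j ∈ S, s ∈ badBatch (uninformative L t) (noisy L' σ (G zstar)) (B j)) (z : Vec k) :
    M < 2 * (Finset.univ.filter fun j =>
      1 / (128 * b) * ‖G z - G zstar‖ ^ 2 - 2 * L' * σ ^ 2 ≤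
        batchLoss G s (B j) z - batchLoss G s (B j) zstar).card := by
  classical
  by_cases hz : G z = G zstar
  · have h0 : ∀ j, 1 / (128 * b) * ‖G z - G zstar‖ ^ 2 - 2 * L' * σ ^ 2 ≤
        batchLoss G s (B j) z - batchLoss G s (B j) zstar := by
      intro j
      have : batchLoss G s (B j) z = batchLoss G s (B j) zstar := by simp [batchLoss, hz]
      rw [this, hz]
      simp
      positivity
    simp only [h0]
    simp
    omega
  obtain ⟨t, htT, ht⟩ := hT z hz
  have hu : G z - G zstar ≠ 0 := sub_ne_zero.2 hz
  have hgrow : ∀ j, s ∉ badBatch (uninformative L t) (noisy L' σ (G zstar)) (B j) →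
      1 / (128 * b) * ‖G z - G zstar‖ ^ 2 - 2 * L' * σ ^ 2 ≤
        batchLoss G s (B j) z - batchLoss G s (B j) zstar := by
    intro j hj
    simp only [badBatch, Set.mem_ofPred_eq, not_or, not_forall, not_exists, not_and] at hj
    obtain ⟨⟨i₀, hi₀, hinf⟩, hnoise⟩ := hj
    obtain ⟨h1, h2⟩ := not_not.1 hinf
    have h3 := (le_abs_inner_of_net hn hL hN hu ht h1 h2).2
    have h4 : (‖G z - G zstar‖ / 8) ^ 2 ≤ (inner ℝ (s i₀).1 (G z - G zstar)) ^ 2 := by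
      rw [← sq_abs (inner ℝ _ _)]
      gcongr
    refine le_trans (le_of_eq ?_) (le_batchLoss_sub i₀ hi₀ h4 fun i hi => not_lt.1 (hnoise i hi))
    rw [hB.card]
    field_simp
    ring
  have ht0 : t ≠ 0 := by
    rintro rfl
    exact (le_abs_inner_of_net (a := 0) hn hL hN hu ht (by simp) (by simp; positivity)).1 rfl
  have hbad := hgood t htT ht0
  set S : Finset (Fin M) :=
    {j | s ∈ badBatch (uninformative L t) (noisy L' σ (G zstar)) (B j)} with hS
  have hScard : 2 * S.card < M := by
    by_contra! hle
    exact hbad ⟨S, hle, by simp [hS]⟩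
  have hcompl : S.card + Sᶜ.card = M := by simp
  have hle : Sᶜ.card ≤ (Finset.univ.filter fun j =>
      1 / (128 * b) * ‖G z - G zstar‖ ^ 2 - 2 * L' * σ ^ 2 ≤
        batchLoss G s (B j) z - batchLoss G s (B j) zstar).card := by
    refine Finset.card_le_card fun j hj => ?_
    simp only [hS, Finset.mem_compl, Finset.mem_filter, Finset.mem_univ, true_and] at hj ⊢
    exact hgrow j hj
  omega

end Tournament

/-! ### Constants -/

theorem IsHeavyTailed.mono {n : ℕ} {μ : Measure (Vec n)} {C C' : ℝ} (h : IsHeavyTailed C μ)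
    (hC : C ≤ C') : IsHeavyTailed C' μ := fun u => (h u).trans (by gcongr)

theorem net_card_mul_le_exp {k d n M b R : ℕ} (hk : 1 ≤ k) (hd : 1 ≤ d) (hn : 2 ≤ n) (hb : 0 < b)
    (hK : 2 * b * (4 + 2 * (Real.log (2 * R + 1) / Real.log 2)) * (k * d * Real.log n) ≤ b * M) :
    ((n : ℝ) + 1) ^ (k * d) * (2 * (R * n) + 1) ^ (k + 1) * (1 / 4) ^ M ≤
      Real.exp (-(1 / (2 * b)) * (b * M)) := by
  have hn' : (2 : ℝ) ≤ n := by exact_mod_cast hn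
  have hk' : (1 : ℝ) ≤ k := by exact_mod_cast hk
  have hd' : (1 : ℝ) ≤ d := by exact_mod_cast hd
  have hb' : (0 : ℝ) < b := by exact_mod_cast hb
  have hR : (0 : ℝ) ≤ R := by positivity
  set ℓ := Real.log n
  have hl2 : 0 < Real.log 2 := Real.log_pos (by norm_num)
  have hℓ : Real.log 2 ≤ ℓ := Real.log_le_log (by norm_num) hn'
  set h := Real.log (2 * R + 1) / Real.log 2 with hh
  have hlogH : 0 ≤ Real.log (2 * R + 1) := Real.log_nonneg (by linarith)
  have hh0 : 0 ≤ h := by positivity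
  have hlogH' : Real.log (2 * R + 1) ≤ h * ℓ := by
    calc Real.log (2 * R + 1) = h * Real.log 2 := by rw [hh]; field_simp
      _ ≤ h * ℓ := by gcongr
  have h1 : (n : ℝ) + 1 ≤ Real.exp (2 * ℓ) := by
    rw [two_mul, Real.exp_add, Real.exp_log (by linarith)]
    nlinarith
  have h2 : 2 * (R * (n : ℝ)) + 1 ≤ Real.exp ((h + 1) * ℓ) := by
    calc 2 * (R * (n : ℝ)) + 1 ≤ (2 * R + 1) * n := by linarith
      _ = Real.exp (Real.log (2 * R + 1) + ℓ) := by
        rw [Real.exp_add, Real.exp_log (by linarith), Real.exp_log (by linarith)]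
      _ ≤ _ := Real.exp_le_exp.2 (by linarith)
  have h3 : (1 / 4 : ℝ) ≤ Real.exp (-1) := by
    rw [Real.exp_neg, one_div]
    exact inv_anti₀ (Real.exp_pos _) (by linarith [Real.exp_one_lt_d9])
  have hK' : (4 + 2 * h) * (k * d * ℓ) ≤ M / 2 := by
    have : b * (2 * ((4 + 2 * h) * (k * d * ℓ))) ≤ b * M := by linarith
    have := le_of_mul_le_mul_left this hb'
    linarith
  have hkd : (k : ℝ) + 1 ≤ 2 * (k * d) := by nlinarith
  calc ((n : ℝ) + 1) ^ (k * d) * (2 * (R * n) + 1) ^ (k + 1) * (1 / 4) ^ M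
      ≤ Real.exp (2 * ℓ) ^ (k * d) * Real.exp ((h + 1) * ℓ) ^ (k + 1) * Real.exp (-1) ^ M := by
        gcongr
    _ = Real.exp (((k * d : ℕ) : ℝ) * (2 * ℓ) + ((k + 1 : ℕ) : ℝ) * ((h + 1) * ℓ) + M * (-1)) := by
        rw [Real.exp_add, Real.exp_add, Real.exp_nat_mul, Real.exp_nat_mul, Real.exp_nat_mul]
    _ ≤ Real.exp (-(1 / (2 * b)) * (b * M)) := by
        rw [Real.exp_le_exp]
        have h4 : -(1 / (2 * b)) * (b * M) = -(M / 2 : ℝ) := by field_simp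
        rw [h4]
        push_cast
        have hp : 0 ≤ (h + 1) * ℓ := mul_nonneg (by linarith) (by linarith)
        have h5 := mul_le_mul_of_nonneg_right hkd hp
        linarith

theorem exists_constants (C : ℝ) :
    ∃ (C₁ L ε₀ : ℝ) (b : ℕ), C ≤ C₁ ∧ 0 < C₁ ∧ 1 ≤ L ∧ 0 < b ∧ 0 < ε₀ ∧ ε₀ < 1 ∧
      ∀ ε, 0 ≤ ε → ε ≤ ε₀ → 0 ≤ 1 - 1 / (2 * C₁ ^ 4) + 1 / L ∧
        (1 - 1 / (2 * C₁ ^ 4) + 1 / L + ε) ^ b + b * (1 / (256 * b) + ε) ≤ 1 / 64 := by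
  set C₁ := max C 1
  have hC₁ : 1 ≤ C₁ := le_max_right _ _
  set p := 1 / (2 * C₁ ^ 4) with hp
  have hC4 : 1 ≤ C₁ ^ 4 := one_le_pow₀ hC₁
  have hp0 : 0 < p := by positivity
  have hp1 : p ≤ 1 / 2 := by
    rw [hp, div_le_div_iff₀ (by positivity) (by norm_num)]
    linarith
  obtain ⟨b, hb⟩ := exists_pow_lt_of_lt_one (show (0 : ℝ) < 1 / 128 by norm_num)
    (show 1 - p / 2 < 1 by linarith)
  have hb0 : 0 < b := by
    rcases Nat.eq_zero_or_pos b with rfl | h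
    · norm_num at hb
    · exact h
  have hb' : (0 : ℝ) < b := by exact_mod_cast hb0
  refine ⟨C₁, 4 / p, min (p / 4) (1 / (256 * b)), b, le_max_left _ _, by positivity, ?_, hb0,
    by positivity, (min_le_left _ _).trans_lt (by linarith), fun ε hε hε₀ => ?_⟩
  · rw [le_div_iff₀ hp0]
    linarith
  have h1 : ε ≤ p / 4 := hε₀.trans (min_le_left _ _)
  have h2 : ε ≤ 1 / (256 * b) := hε₀.trans (min_le_right _ _)
  have h3 : 1 / (4 / p) = p / 4 := by simp
  rw [h3]
  refine ⟨by linarith, ?_⟩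
  have h4 : (1 - p + p / 4 + ε) ^ b ≤ (1 - p / 2) ^ b :=
    pow_le_pow_left₀ (by linarith) (by linarith) b
  have h5 : b * (1 / (256 * b) + ε) ≤ 1 / 128 := by
    calc b * (1 / (256 * b) + ε) ≤ b * (1 / (256 * b) + 1 / (256 * b)) := by gcongr
      _ = 1 / 128 := by field_simp; norm_num
  linarith

theorem measure_half_badBatch_contaminated_le {n m M b : ℕ} (hn : 0 < n)
    {C L L' ε σ : ℝ} (hC : 0 < C) (hL : 0 < L) (hL' : 0 < L') (hε : 0 ≤ ε)
    (hnn : 0 ≤ 1 - 1 / (2 * C ^ 4) + 1 / L)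
    (hbnd : (1 - 1 / (2 * C ^ 4) + 1 / L + ε) ^ b + b * (1 / L' + ε) ≤ 1 / 64)
    {x t : Vec n} (ht : t ≠ 0) {μ : Measure (Vec n)} [IsProbabilityMeasure μ]
    {ν : Measure ℝ} [IsProbabilityMeasure ν] (hμ : IsIsotropic μ) (hμ' : IsHeavyTailed C μ)
    (hν : IsNoise σ ν) {Q : Measure (Vec n × ℝ)} [IsProbabilityMeasure Q]
    {B : Fin M → Finset (Fin m)} (hB : IsBatchPartition b B)
    {Ω : Type*} [MeasurableSpace Ω] {Pr : Measure Ω} [IsProbabilityMeasure Pr]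
    {X : Fin m → Ω → Vec n × ℝ} (hX : iIndepFun X Pr)
    (hlaw : ∀ i, HasLaw (X i) (contaminated ε (cleanLaw x μ ν) Q) Pr) :
    Pr {ω | ∃ S : Finset (Fin M), M ≤ 2 * S.card ∧
      ∀ j ∈ S, (fun i => X i ω) ∈ badBatch (uninformative L t) (noisy L' σ x) (B j)} ≤
      ENNReal.ofReal ((1 / 4) ^ M) := by
  have hU : contaminated ε (cleanLaw x μ ν) Q (uninformative L t) ≤
      ENNReal.ofReal (1 - 1 / (2 * C ^ 4) + 1 / L + ε) := by
    rw [ENNReal.ofReal_add hnn hε]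
    exact (contaminated_apply_le hε _ _ _).trans
      (by gcongr; exact cleanLaw_uninformative_le hC hμ hμ' hn hL ht)
  have hN : contaminated ε (cleanLaw x μ ν) Q (noisy L' σ x) ≤ ENNReal.ofReal (1 / L' + ε) := by
    rw [ENNReal.ofReal_add (by positivity) hε]
    exact (contaminated_apply_le hε _ _ _).trans (by gcongr; exact cleanLaw_noisy_le hν hL')
  have h1 : (2 * ENNReal.ofReal (1 / 8)) ^ M = ENNReal.ofReal ((1 / 4) ^ M) := by
    rw [ENNReal.ofReal_pow (by norm_num), ← ENNReal.ofReal_ofNat 2,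
      ← ENNReal.ofReal_mul (by norm_num)]
    norm_num
  rw [← h1]
  refine measure_half_badBatch_le hX hlaw (measurableSet_uninformative L t)
    (measurableSet_noisy L' σ x) hB.disjoint
    (by rw [← ENNReal.ofReal_one]; exact ENNReal.ofReal_le_ofReal (by norm_num)) fun j => ?_
  refine (measure_badBatch_le hX hlaw (measurableSet_uninformative L t)
    (measurableSet_noisy L' σ x) (B j)).trans ?_
  rw [hB.card j]
  have hq := add_nonneg hnn hε
  set q := 1 - 1 / (2 * C ^ 4) + 1 / L + ε
  clear_value q
  calc _ ≤ ENNReal.ofReal q ^ b + b * ENNReal.ofReal (1 / L' + ε) := by gcongr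
    _ = ENNReal.ofReal (q ^ b + b * (1 / L' + ε)) := by
      rw [ENNReal.ofReal_add (p := q ^ b) (by positivity) (by positivity), ENNReal.ofReal_pow hq,
        ENNReal.ofReal_mul (by positivity), ENNReal.ofReal_natCast]
    _ ≤ ENNReal.ofReal (1 / 64) := ENNReal.ofReal_le_ofReal hbnd
    _ = ENNReal.ofReal (1 / 8) ^ 2 := by rw [← ENNReal.ofReal_pow (by norm_num)]; norm_num

end RobustGen

theorem mainTheorem1 (C : ℝ) (hC : 0 < C) :
    ∃ (ε₀ : ℝ) (b : ℕ) (K c c' : ℝ),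
      0 < ε₀ ∧ ε₀ < 1 ∧ 0 < b ∧ 0 < K ∧ 0 < c ∧ 0 < c' ∧
      ∀ (k d n m M : ℕ), 2 ≤ n → K * (k * d * Real.log n) ≤ m →
      ∀ (G : RobustGen.Vec k → RobustGen.Vec n), RobustGen.IsReLUNetwork n d k n G →
      ∀ (zstar : RobustGen.Vec k) (σ : ℝ)
        (μ : Measure (RobustGen.Vec n)) [IsProbabilityMeasure μ]
        (ν : Measure ℝ) [IsProbabilityMeasure ν],
        RobustGen.IsIsotropic μ → RobustGen.IsHeavyTailed C μ → RobustGen.IsNoise σ ν →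
      ∀ (ε : ℝ), 0 ≤ ε → ε ≤ ε₀ →
      ∀ (Q : Measure (RobustGen.Vec n × ℝ)) [IsProbabilityMeasure Q]
        (B : Fin M → Finset (Fin m)), RobustGen.IsBatchPartition b B →
      ∀ {Ω : Type*} [MeasurableSpace Ω] (Pr : Measure Ω) [IsProbabilityMeasure Pr]
        (X : Fin m → Ω → RobustGen.Vec n × ℝ), iIndepFun X Pr →
        (∀ i, HasLaw (X i)
          (RobustGen.contaminated ε (RobustGen.cleanLaw (G zstar) μ ν) Q) Pr) →
        Pr {ω | ¬ ∀ (τ : ℝ) (zhat : RobustGen.Vec k),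
              RobustGen.IsApproxMinimizer G (fun i => X i ω) B τ zhat →
              ‖G zhat - G zstar‖ ^ 2 ≤ c * (σ ^ 2 + τ)}
          ≤ ENNReal.ofReal (Real.exp (-c' * m)) := by
  obtain ⟨C₁, L, ε₀, b, hCC₁, hC₁, hL, hb, hε₀, hε₀1, hbnd⟩ := RobustGen.exists_constants C
  have hb' : (1 : ℝ) ≤ b := by exact_mod_cast hb
  set R : ℕ := ⌈8 * √L⌉₊ with hR
  have hR8 : 8 * √L ≤ R := Nat.le_ceil _
  have hR0 : 0 < R := Nat.ceil_pos.2 (by positivity)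
  have hlog : 0 ≤ Real.log (2 * R + 1) / Real.log 2 :=
    div_nonneg (Real.log_nonneg (by linarith [(Nat.cast_nonneg R : (0 : ℝ) ≤ R)]))
      (Real.log_nonneg (by norm_num))
  refine ⟨ε₀, b, 2 * b * (4 + 2 * (Real.log (2 * R + 1) / Real.log 2)), 128 * b * (1024 * b),
    1 / (2 * b), hε₀, hε₀1, hb, by positivity, by positivity, by positivity, ?_⟩
  intro k d n m M hn hm G hG zstar σ μ _ ν _ hμ hμ' hν ε hε hεε₀ Q _ B hB Ω _ Pr _ X hX hlaw
  classical
  have hmb : m = b * M := hB.mul_eq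
  rcases Nat.eq_zero_or_pos k with rfl | hk
  · refine (measure_mono_null (t := ∅) ?_ measure_empty).trans_le zero_le
    intro ω hω
    refine hω fun τ zhat h => ?_
    rw [Subsingleton.elim zhat zstar]
    have := h.nonneg
    simp only [sub_self, norm_zero, ne_eq, OfNat.ofNat_ne_zero, not_false_eq_true, zero_pow]
    positivity
  rcases Nat.eq_zero_or_pos M with rfl | hM
  · simpa [hmb] using prob_le_one
  have hn0 : 0 < n := by omega
  obtain ⟨T, hTcard, hT⟩ := hG.exists_direction_net le_rfl (G zstar) (N := R * n) (by positivity)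
  obtain ⟨hnn, hbnd⟩ := hbnd ε hε hεε₀
  set bad : RobustGen.Vec n → Set Ω := fun t => {ω | ∃ S : Finset (Fin M), M ≤ 2 * S.card ∧
    ∀ j ∈ S, (fun i => X i ω) ∈ RobustGen.badBatch (RobustGen.uninformative L t)
      (RobustGen.noisy (256 * b) σ (G zstar)) (B j)} with hbad
  have hsub : {ω | ¬ ∀ (τ : ℝ) (zhat : RobustGen.Vec k),
      RobustGen.IsApproxMinimizer G (fun i => X i ω) B τ zhat →
      ‖G zhat - G zstar‖ ^ 2 ≤ 128 * b * (1024 * b) * (σ ^ 2 + τ)} ⊆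
      ⋃ t ∈ T.filter (· ≠ 0), bad t := by
    intro ω hω
    by_contra hgood
    refine hω fun τ zhat h => ?_
    simp only [Finset.mem_filter, Set.mem_iUnion, not_exists] at hgood
    have h1 := h.mul_norm_sq_le (by positivity) (RobustGen.lt_card_quadratic_growth hB hb hM hn0 hL
      (by positivity : (0 : ℝ) ≤ 256 * b) (by push_cast; gcongr) hT
      fun t ht ht0 => hgood t ⟨ht, ht0⟩)
    have h2 := h.nonneg
    rw [one_div, inv_mul_le_iff₀ (by positivity)] at h1
    refine h1.trans ?_
    have h3 : 1 * τ ≤ 1024 * b * τ := by gcongr; linarith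
    rw [mul_assoc (128 * (b : ℝ))]
    exact mul_le_mul_of_nonneg_left (by linarith) (by positivity)
  have hmeas : ∀ t ∈ T.filter (· ≠ 0), Pr (bad t) ≤ ENNReal.ofReal ((1 / 4) ^ M) := fun t ht =>
    RobustGen.measure_half_badBatch_contaminated_le hn0 hC₁ (by linarith) (by positivity) hε hnn
      hbnd (Finset.mem_filter.1 ht).2 hμ (hμ'.mono hCC₁) hν hB hX hlaw
  have hm' : (m : ℝ) = b * M := by rw [hmb]; push_cast; ring
  rw [hm'] at hm ⊢
  calc _ ≤ ∑ t ∈ T.filter (· ≠ 0), Pr (bad t) :=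
        (measure_mono hsub).trans (measure_biUnion_finset_le _ _)
    _ ≤ ((n + 1) ^ (k * d) * (2 * (R * n) + 1) ^ (k + 1) : ℕ) * ENNReal.ofReal ((1 / 4) ^ M) := by
        refine (Finset.sum_le_sum hmeas).trans ?_
        rw [Finset.sum_const, nsmul_eq_mul]
        gcongr
        exact (Finset.card_filter_le _ _).trans hTcard
    _ = ENNReal.ofReal (((n : ℝ) + 1) ^ (k * d) * (2 * (R * n) + 1) ^ (k + 1) * (1 / 4) ^ M) := by
        rw [← ENNReal.ofReal_natCast, ← ENNReal.ofReal_mul (by positivity)]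
        push_cast
        rfl
    _ ≤ _ := ENNReal.ofReal_le_ofReal (RobustGen.net_card_mul_le_exp hk hG.one_le_depth hn hb hm)
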